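/- Let $E$ be a complex Banach space, let $I=\mathbb{R}$ or $I=[0,\infty)$, and let $c\in\mathbb{C}$ with $|c|=1$ and principal argument $\arg(c)\in(-\pi,\pi]$. A continuous function $f:I\to E$ is called $c$-almost periodic if for every $\varepsilon>0$ the set of all $\tau>0$ with $\|f(t+\tau)-cf(t)\|\le\varepsilon$ for all $t\in I$ is relatively dense in $[0,\infty)$, i.e. there is $l>0$ such that every subinterval of $[0,\infty)$ of length $l$ meets this set. For $c=1$ the function is called almost periodic, and $AP(I:E)$ denotes the space of almost periodic functions $I\to E$ with the supremum norm. For $f\in AP(I:E)$ and $r\in\mathbb{R}$ let $$P_r(f)=\lim_{t\to\infty}\frac1t\int_0^t e^{-irs}f(s)\,ds,\qquad \sigma(f)=\{r\in\mathbb{R}: P_r(f)\neq 0\},$$ and let $AP_{\mathbb{R}\setminus\{0\}}(I:E)$ be the set of all $f\in AP(I:E)$ with $\sigma(f)\subseteq\mathbb{R}\setminus\{0\}$. Let $AP_{c,0}(I:E)$ be the linear span of the $c$-almost periodic functions $I\to E$. Then $AP_{c,0}(I:E)\subseteq AP(I:E)$. Let $\mathbf{AP}_{c,0}(I:E)$ be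 the closure of $AP_{c,0}(I:E)$ in $AP(I:E)$. Then: (i) if $c\neq 1$ and $\arg(c)\in\pi\mathbb{Q}$, then $\mathbf{AP}_{c,0}(I:E)=AP_{\mathbb{R}\setminus\{0\}}(I:E)$; (ii) if $\arg(c)\notin\pi\mathbb{Q}$, then $\mathbf{AP}_{c,0}(I:E)\supseteq AP_{\mathbb{R}\setminus\{0\}}(I:E)$. -/

import Mathlib

namespace CAlmostPeriodic

noncomputable section

/-- `IsApproxPeriod f c ε τ`: the number `τ > 0` is an `(ε, c)`-period of `f : I → E`, that is
`‖f (t + τ) - c f t‖ ≤ ε` for all `t ∈ I`.  The point `t + τ` is written as an element `s` of `I`;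
it exists for every `t ∈ I` when `I` is `ℝ` or `[0, ∞)`. -/
def IsApproxPeriod {E : Type*} [NormedAddCommGroup E] [NormedSpace ℂ E] {I : Set ℝ}
    (f : I → E) (c : ℂ) (ε τ : ℝ) : Prop :=
  0 < τ ∧ ∀ t s : I, (s : ℝ) = (t : ℝ) + τ → ‖f s - c • f t‖ ≤ ε

/-- `S` is relatively dense in `[0, ∞)`: there is `l > 0` such that every subinterval of `[0, ∞)`
of length `l` meets `S`. -/
def RelativelyDense (S : Set ℝ) : Prop :=
  ∃ l : ℝ, 0 < l ∧ ∀ a : ℝ, 0 ≤ a → ∃ τ ∈ S, τ ∈ Set.Icc a (a + l)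

/-- The set of `c`-almost periodic functions `I → E`. -/
def cAP (c : ℂ) (I : Set ℝ) (E : Type*) [NormedAddCommGroup E] [NormedSpace ℂ E] :
    Set (I → E) :=
  {f | Continuous f ∧ ∀ ε : ℝ, 0 < ε → RelativelyDense {τ | IsApproxPeriod f c ε τ}}

/-- The set `AP(I : E)` of (Bohr) almost periodic functions: the case `c = 1`. -/
def AP (I : Set ℝ) (E : Type*) [NormedAddCommGroup E] [NormedSpace ℂ E] : Set (I → E) :=
  cAP 1 I E

/-- `HasBohrFourierCoeff f r a`: the limit `lim_{t → ∞} (1/t) ∫₀ᵗ e^{-irs} f(s) ds` exists and is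
equal to `a`.  (`f` is extended by `0` off `I`; the integrals only see `f` on `[0, t] ⊆ I`.) -/
def HasBohrFourierCoeff {E : Type*} [NormedAddCommGroup E] [NormedSpace ℂ E] {I : Set ℝ}
    (f : I → E) (r : ℝ) (a : E) : Prop :=
  Filter.Tendsto
    (fun t : ℝ => t⁻¹ • ∫ s in (0 : ℝ)..t,
      Complex.exp (-(Complex.I * r * s)) • Function.extend ((↑) : I → ℝ) f 0 s)
    Filter.atTop (nhds a)

/-- The Bohr spectrum: the set of those real `r` at which the Bohr-Fourier coefficient is not `0`.
(For almost periodic `f` the coefficient exists for every `r`.) -/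
def bohrSpectrum {E : Type*} [NormedAddCommGroup E] [NormedSpace ℂ E] {I : Set ℝ}
    (f : I → E) : Set ℝ :=
  {r | ¬ HasBohrFourierCoeff f r 0}

/-- The set of almost periodic functions whose Bohr spectrum is contained in `Λ`. -/
def APSpec (Λ : Set ℝ) (I : Set ℝ) (E : Type*) [NormedAddCommGroup E] [NormedSpace ℂ E] :
    Set (I → E) :=
  {f | f ∈ AP I E ∧ bohrSpectrum f ⊆ Λ}

/-- The linear span of the `c`-almost periodic functions `I → E`. -/
def cAPSpan (c : ℂ) (I : Set ℝ) (E : Type*) [NormedAddCommGroup E] [NormedSpace ℂ E] :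
    Submodule ℂ (I → E) :=
  Submodule.span ℂ (cAP c I E)

/-- The closure in `AP(I : E)`, with respect to the supremum norm, of the linear span of the
`c`-almost periodic functions. -/
def cAPClosure (c : ℂ) (I : Set ℝ) (E : Type*) [NormedAddCommGroup E] [NormedSpace ℂ E] :
    Set (I → E) :=
  {f | f ∈ AP I E ∧ ∀ ε : ℝ, 0 < ε → ∃ g ∈ cAPSpan c I E, ∀ t : I, ‖f t - g t‖ ≤ ε}

end

end CAlmostPeriodic

/-! Both inclusions rest on the exponentials `e^{irt} a`. If `r ≠ 0`, then `e^{irτ} = c` holds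
exactly along an arithmetic progression of `τ`, so every trigonometric polynomial without constant
term lies in the span (`expFun_mem_cAP`). If `f` is almost periodic, Bohr's theorem approximates it
uniformly by trigonometric polynomials; if `f` also has mean zero, the constant terms are small and
can be dropped (`APSpec_subset_cAPClosure`). Conversely, shifting by a `c`-period barely changes a
long average yet nearly multiplies it by `c`, so for `c ≠ 1` the mean vanishes, and this survives
sums and uniform limits (`cAPClosure_subset_APSpec`). The inclusion in `AP` comes from multiples
`kτ` with `c ^ k` close to `1`.

Bohr's theorem is proved through a compact group. The seminorm `sup ‖f (t + s) - f t‖` in `s`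
completes `ℝ` to a compact abelian group `K`. A partition of unity on `K` approximates `f` by finite
sums of `ρ (φ t) • f (p a)`. Characters are uniformly dense in `C(K, ℂ)`, by the spectral theorem
for convolution operators, and pull back to exponentials on `ℝ`. -/

namespace CAlmostPeriodic

/-! ### Characters in finite-dimensional translation-invariant spaces -/

section Characters

variable {K : Type*} [NormedAddCommGroup K]

/-- A continuous function on `K` is a character if it is multiplicative and takes `0` to `1`. -/
def IsCharacter (χ : C(K, ℂ)) : Prop :=
  χ 0 = 1 ∧ ∀ x y, χ (x + y) = χ x * χ y

theorem IsCharacter.mul_neg {χ : C(K, ℂ)} (hχ : IsCharacter χ) (x : K) : χ x * χ (-x) = 1 := by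
  rw [← hχ.2, add_neg_cancel, hχ.1]

/-- Translation of continuous functions by `y`. -/
noncomputable def translate (y : K) : C(K, ℂ) →ₗ[ℂ] C(K, ℂ) where
  toFun f := f.comp ⟨fun x => x + y, by fun_prop⟩
  map_add' _ _ := rfl
  map_smul' _ _ := rfl

@[simp] theorem translate_apply (y : K) (f : C(K, ℂ)) (x : K) : translate y f x = f (x + y) := rfl

variable [CompactSpace K]

/-- A value of modulus above `1` would have unbounded powers along the multiples of `x`. -/
theorem IsCharacter.norm_le_one {χ : C(K, ℂ)} (hχ : IsCharacter χ) (x : K) : ‖χ x‖ ≤ 1 := by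
  by_contra! h
  have hpow : ∀ n : ℕ, χ (n • x) = χ x ^ n := by
    intro n
    induction n with
    | zero => simpa using hχ.1
    | succ n ih => rw [succ_nsmul, hχ.2, ih, pow_succ]
  obtain ⟨n, hn⟩ := pow_unbounded_of_one_lt ‖χ‖ h
  have := χ.norm_coe_le_norm (n • x)
  rw [hpow, norm_pow] at this
  linarith

theorem IsCharacter.norm_eq_one {χ : C(K, ℂ)} (hχ : IsCharacter χ) (x : K) : ‖χ x‖ = 1 := by
  have h1 := congrArg norm (hχ.mul_neg x)
  rw [norm_mul, norm_one] at h1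
  have h2 := hχ.norm_le_one x
  have h3 := hχ.norm_le_one (-x)
  nlinarith [norm_nonneg (χ x), norm_nonneg (χ (-x))]

/-- A subspace of `C(K, ℂ)` invariant under all translations. -/
def IsTranslationInvariant (V : Submodule ℂ C(K, ℂ)) : Prop :=
  ∀ y, ∀ f ∈ V, translate y f ∈ V

/-- If every translation acts on `V` as a scalar, a nonzero element divided by its value at `0` is a
character. Otherwise some translation has a proper nonzero eigenspace in `V`, invariant because
translations commute, and induction on the dimension applies. -/
theorem exists_isCharacter_mem (V : Submodule ℂ C(K, ℂ)) [FiniteDimensional ℂ V]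
    (hV : IsTranslationInvariant V) (hne : V ≠ ⊥) : ∃ χ ∈ V, IsCharacter χ := by
  induction h : Module.finrank ℂ V using Nat.strong_induction_on generalizing V with
  | _ n ih =>
  by_cases hs : ∀ y, ∃ a : ℂ, ∀ f ∈ V, translate y f = a • f
  · choose a ha using hs
    obtain ⟨v, hvV, hv⟩ := V.ne_bot_iff.1 hne
    have hva : ∀ x y, v (x + y) = a y * v x := fun x y => by
      have := congrArg (fun g : C(K, ℂ) => g x) (ha y v hvV)
      simpa using this
    have hv0 : v 0 ≠ 0 := by
      intro h0
      apply hv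
      ext x
      have := hva 0 x
      rw [zero_add] at this
      simp [this, h0]
    refine ⟨(v 0)⁻¹ • v, V.smul_mem _ hvV, ?_, fun x y => ?_⟩
    · simp [hv0]
    · have h1 := hva x y
      have h2 := hva 0 y
      rw [zero_add] at h2
      simp only [ContinuousMap.smul_apply, smul_eq_mul]
      rw [h1, h2]
      field_simp
  · push Not at hs
    obtain ⟨y, hy⟩ := hs
    have : Nontrivial V := (Submodule.nontrivial_iff_ne_bot).2 hne
    obtain ⟨α, hα⟩ := Module.End.exists_eigenvalue ((translate y).restrict (hV y))
    obtain ⟨w, hw⟩ := hα.exists_hasEigenvector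
    obtain ⟨f, hfV, hf⟩ := hy α
    let W : Submodule ℂ C(K, ℂ) := V ⊓ LinearMap.ker (translate y - α • LinearMap.id)
    have hWV : W ≤ V := inf_le_left
    have hWmem : ∀ g, g ∈ W ↔ g ∈ V ∧ translate y g = α • g := fun g => by
      simp [W, sub_eq_zero]
    have hlt : W < V := lt_of_le_of_ne hWV fun h => hf (((hWmem f).1 (h ▸ hfV)).2)
    have : FiniteDimensional ℂ W := Submodule.finiteDimensional_of_le hWV
    obtain ⟨χ, hχ, hc⟩ := ih _ (h ▸ Submodule.finrank_lt_finrank_of_lt hlt) W (fun z g hg => by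
      rw [hWmem] at hg ⊢
      refine ⟨hV z g hg.1, ?_⟩
      rw [← map_smul, ← hg.2]
      ext x
      simp [add_assoc, add_comm y z]) (by
      rw [Submodule.ne_bot_iff]
      refine ⟨w, (hWmem _).2 ⟨w.2, ?_⟩, fun h => hw.2 (Subtype.ext h)⟩
      exact congrArg Subtype.val hw.apply_eq_smul) rfl
    exact ⟨χ, hWV hχ, hc⟩

variable [MeasurableSpace K] [BorelSpace K]

open MeasureTheory

/-- The linear span of the characters. -/
noncomputable def charSpan (K : Type*) [NormedAddCommGroup K] [CompactSpace K] :
    Submodule ℂ C(K, ℂ) :=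
  Submodule.span ℂ {χ | IsCharacter χ}

theorem integrable_continuousMap (μ : Measure K) [IsFiniteMeasure μ] (f : C(K, ℂ)) :
    Integrable f μ :=
  f.continuous.integrable_of_hasCompactSupport (HasCompactSupport.of_compactSpace _)

/-- Split off one character at a time: the kernel in `V` of the Fourier coefficient at `χ` is a
complement to `χ`, and it is invariant because Haar measure is. -/
theorem le_charSpan (μ : Measure K) [IsFiniteMeasure μ] [NeZero μ] [μ.IsAddHaarMeasure]
    (V : Submodule ℂ C(K, ℂ)) [FiniteDimensional ℂ V] (hV : IsTranslationInvariant V) :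
    V ≤ charSpan K := by
  induction h : Module.finrank ℂ V using Nat.strong_induction_on generalizing V with
  | _ n ih =>
  by_cases hne : V = ⊥
  · simp [hne]
  obtain ⟨χ, hχV, hχ⟩ := exists_isCharacter_mem V hV hne
  let φ : C(K, ℂ) →ₗ[ℂ] ℂ :=
    { toFun := fun f => ∫ x, χ (-x) * f x ∂μ
      map_add' := fun f g => by
        simp only [ContinuousMap.add_apply, mul_add]
        exact integral_add (integrable_continuousMap μ ((χ.comp ⟨fun x => -x, by fun_prop⟩) * f))
          (integrable_continuousMap μ ((χ.comp ⟨fun x => -x, by fun_prop⟩) * g))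
      map_smul' := fun a f => by
        simp only [ContinuousMap.smul_apply, smul_eq_mul, RingHom.id_apply]
        rw [← integral_const_mul]
        congr 1; ext x; ring }
  have hφ : ∀ f, φ f = ∫ x, χ (-x) * f x ∂μ := fun f => rfl
  have hφχ : φ χ ≠ 0 := by
    have : φ χ = (μ.real Set.univ : ℂ) := by
      rw [hφ]
      simp [mul_comm, hχ.mul_neg]
    rw [this]
    exact Complex.ofReal_ne_zero.2 measureReal_univ_ne_zero
  let W : Submodule ℂ C(K, ℂ) := V ⊓ LinearMap.ker φ
  have hWV : W ≤ V := inf_le_left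
  have hlt : W < V := lt_of_le_of_ne hWV fun h => hφχ (by
    have : χ ∈ W := h ▸ hχV
    exact this.2)
  have : FiniteDimensional ℂ W := Submodule.finiteDimensional_of_le hWV
  have hW : W ≤ charSpan K := ih _ (h ▸ Submodule.finrank_lt_finrank_of_lt hlt) W
    (fun z g hg => ⟨hV z g hg.1, by
      have h0 : φ g = 0 := hg.2
      change φ (translate z g) = 0
      have h1 : φ (translate z g) = χ z * φ g := by
        rw [hφ, hφ, ← integral_const_mul,
          ← integral_add_right_eq_self (fun x => χ z * (χ (-x) * g x)) z]
        congr 1; ext x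
        rw [translate_apply, ← mul_assoc, ← hχ.2]
        congr 2; abel
      rw [h1, h0, mul_zero]⟩) rfl
  intro v hv
  have h2 : v - (φ v / φ χ) • χ ∈ W :=
    ⟨V.sub_mem hv (V.smul_mem _ hχV), by
      change φ _ = 0
      rw [map_sub, map_smul, smul_eq_mul, div_mul_cancel₀ _ hφχ, sub_self]⟩
  have h3 := (charSpan K).add_mem (hW h2)
    ((charSpan K).smul_mem (φ v / φ χ) (Submodule.subset_span hχ))
  simpa using h3

end Characters

/-! ### Convolution as a compact self-adjoint operator -/

section Convolution

open MeasureTheory Filter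
open scoped InnerProductSpace

variable {K : Type*} [NormedAddCommGroup K]

/-- The family `x ↦ k (x - ·)` of continuous functions. -/
noncomputable def convFamily (k : C(K, ℂ)) : C(K, C(K, ℂ)) :=
  ContinuousMap.curry ⟨fun p : K × K => k (p.1 - p.2), by fun_prop⟩

@[simp] theorem convFamily_apply (k : C(K, ℂ)) (x y : K) : convFamily k x y = k (x - y) := rfl

variable [CompactSpace K] [MeasurableSpace K] [BorelSpace K]
  (μ : Measure K) [IsFiniteMeasure μ]

/-- The family `x ↦ k (x - ·)` as a continuous family in `L²`. -/
noncomputable def convFamilyLp (k : C(K, ℂ)) : C(K, Lp ℂ 2 μ) :=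
  ⟨fun x => ContinuousMap.toLp 2 μ ℂ (convFamily k x), by fun_prop⟩

/-- Convolution with a (real-valued) kernel `k`, as an operator from `L²` to `C(K, ℂ)`. -/
noncomputable def convL (k : C(K, ℂ)) : Lp ℂ 2 μ →L[ℂ] C(K, ℂ) :=
  LinearMap.mkContinuous
    { toFun := fun v => ⟨fun x => ⟪convFamilyLp μ k x, v⟫_ℂ, by fun_prop⟩
      map_add' := fun u v => by ext x; simp [inner_add_right]
      map_smul' := fun a v => by ext x; simp [inner_smul_right] }
    ‖convFamilyLp μ k‖ (fun v => by
      rw [ContinuousMap.norm_le _ (by positivity)]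
      intro x
      refine (norm_inner_le_norm (𝕜 := ℂ) (convFamilyLp μ k x) v).trans ?_
      gcongr
      exact ContinuousMap.norm_coe_le_norm (convFamilyLp μ k) x)

theorem convL_apply (k : C(K, ℂ)) (v : Lp ℂ 2 μ) (x : K) :
    convL μ k v x = ⟪convFamilyLp μ k x, v⟫_ℂ := rfl

theorem convL_toLp (k : C(K, ℂ)) (hk : ∀ x, starRingEnd ℂ (k x) = k x) (u : C(K, ℂ)) (x : K) :
    convL μ k (ContinuousMap.toLp 2 μ ℂ u) x = ∫ y, u y * k (x - y) ∂μ := by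
  rw [convL_apply]
  change ⟪ContinuousMap.toLp 2 μ ℂ (convFamily k x), _⟫_ℂ = _
  rw [ContinuousMap.inner_toLp]
  simp [hk]

/-- Arzelà–Ascoli: by Cauchy–Schwarz, continuity of `x ↦ k (x - ·)` into `L²` makes the image of the
unit ball equicontinuous. -/
theorem isCompactOperator_convL (k : C(K, ℂ)) : IsCompactOperator (convL μ k) := by
  refine (isCompactOperator_iff_image_closedBall_subset_compact
    (convL μ k).toLinearMap one_pos).2 ?_
  let A : Set (BoundedContinuousFunction K ℂ) :=
    (fun v => BoundedContinuousFunction.mkOfCompact (convL μ k v)) '' Metric.closedBall 0 1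
  have hA : IsCompact (closure A) := by
    refine BoundedContinuousFunction.arzela_ascoli (Metric.closedBall 0 ‖convL μ k‖)
      (isCompact_closedBall _ _) A ?_ ?_
    · rintro _ x ⟨v, hv, rfl⟩
      rw [mem_closedBall_zero_iff] at hv ⊢
      calc ‖convL μ k v x‖ ≤ ‖convL μ k v‖ := ContinuousMap.norm_coe_le_norm _ x
        _ ≤ ‖convL μ k‖ * ‖v‖ := (convL μ k).le_opNorm v
        _ ≤ ‖convL μ k‖ * 1 := by gcongr
        _ = _ := mul_one _
    · intro x₀
      rw [Metric.equicontinuousAt_iff]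
      intro ε hε
      obtain ⟨δ, hδ, h⟩ := Metric.continuousAt_iff.1
        ((convFamilyLp μ k).continuous.continuousAt (x := x₀)) ε hε
      refine ⟨δ, hδ, fun x hx => ?_⟩
      rintro ⟨_, v, hv, rfl⟩
      rw [mem_closedBall_zero_iff] at hv
      change dist (convL μ k v x₀) (convL μ k v x) < ε
      rw [convL_apply, convL_apply, dist_comm, dist_eq_norm, ← inner_sub_left]
      refine (norm_inner_le_norm _ _).trans_lt ?_
      have := h hx
      rw [dist_eq_norm] at this
      nlinarith [norm_nonneg (convFamilyLp μ k x - convFamilyLp μ k x₀)]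
  refine ⟨(ContinuousMap.isometryEquivBoundedOfCompact K ℂ).symm '' closure A,
    hA.image (ContinuousMap.isometryEquivBoundedOfCompact K ℂ).symm.continuous, ?_⟩
  rintro _ ⟨v, hv, rfl⟩
  exact ⟨_, subset_closure ⟨v, hv, rfl⟩, rfl⟩

/-- Convolution with `k` as an operator on `L²`. -/
noncomputable def convLp (k : C(K, ℂ)) : Lp ℂ 2 μ →L[ℂ] Lp ℂ 2 μ :=
  (ContinuousMap.toLp 2 μ ℂ).comp (convL μ k)

theorem isCompactOperator_convLp (k : C(K, ℂ)) : IsCompactOperator (convLp μ k) :=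
  (isCompactOperator_convL μ k).clm_comp (ContinuousMap.toLp 2 μ ℂ)

/-- Fubini on continuous functions, where the kernel is real and even; density extends the identity
to `L²`. -/
theorem isSymmetric_convLp (k : C(K, ℂ)) (hk : ∀ x, starRingEnd ℂ (k x) = k x)
    (hk' : ∀ x, k (-x) = k x) : (convLp μ k).toLinearMap.IsSymmetric := by
  intro u v
  change ⟪convLp μ k u, v⟫_ℂ = ⟪u, convLp μ k v⟫_ℂ
  have hd : DenseRange (ContinuousMap.toLp 2 μ ℂ : C(K, ℂ) → Lp ℂ 2 μ) :=
    ContinuousMap.toLp_denseRange ℂ μ ℂ (by norm_num)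
  refine DenseRange.induction_on₂ (p := fun u v => ⟪convLp μ k u, v⟫_ℂ = ⟪u, convLp μ k v⟫_ℂ) hd
    (isClosed_eq (by fun_prop) (by fun_prop)) (fun f g => ?_) u v
  change ⟪ContinuousMap.toLp 2 μ ℂ (convL μ k _), _⟫_ℂ =
    ⟪_, ContinuousMap.toLp 2 μ ℂ (convL μ k _)⟫_ℂ
  rw [ContinuousMap.inner_toLp, ContinuousMap.inner_toLp]
  simp_rw [convL_toLp μ k hk, ← integral_conj, ← integral_const_mul, ← integral_mul_const]
  rw [integral_integral_swap]
  · congr 1; ext y; congr 1; ext x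
    simp only [map_mul, hk]
    rw [← neg_sub, hk']
    ring
  · refine Continuous.integrable_of_hasCompactSupport ?_ (HasCompactSupport.of_compactSpace _)
    have : Continuous (starRingEnd ℂ) := Complex.continuous_conj
    simp only [Function.uncurry_def]
    fun_prop

end Convolution

/-! ### Uniform density of characters (Peter–Weyl, abelian case) -/

section Density

open MeasureTheory Filter

variable {K : Type*} [NormedAddCommGroup K] [CompactSpace K] [MeasurableSpace K] [BorelSpace K]
  (μ : Measure K) [IsFiniteMeasure μ]

/-- The continuous eigenfunctions of the convolution operator. -/
noncomputable def convEigenspace (k : C(K, ℂ)) (a : ℂ) : Submodule ℂ C(K, ℂ) :=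
  LinearMap.ker ((convL μ k).toLinearMap ∘ₗ (ContinuousMap.toLp 2 μ ℂ).toLinearMap -
    a • LinearMap.id)

theorem mem_convEigenspace (k : C(K, ℂ)) (a : ℂ) (f : C(K, ℂ)) :
    f ∈ convEigenspace μ k a ↔ convL μ k (ContinuousMap.toLp 2 μ ℂ f) = a • f := by
  simp [convEigenspace, sub_eq_zero]

variable [μ.IsAddHaarMeasure]

theorem convL_toLp_translate (k : C(K, ℂ)) (hk : ∀ x, starRingEnd ℂ (k x) = k x)
    (y : K) (f : C(K, ℂ)) :
    convL μ k (ContinuousMap.toLp 2 μ ℂ (translate y f)) =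
      translate y (convL μ k (ContinuousMap.toLp 2 μ ℂ f)) := by
  ext x
  rw [translate_apply, convL_toLp μ k hk, convL_toLp μ k hk,
    ← integral_add_right_eq_self (fun z => f z * k (x + y - z)) y]
  simp

/-- Compactness makes the eigenspace finite-dimensional, and convolution commutes with translations.
-/
theorem convEigenspace_le_charSpan (k : C(K, ℂ)) (hk : ∀ x, starRingEnd ℂ (k x) = k x)
    {a : ℂ} (ha : a ≠ 0) : convEigenspace μ k a ≤ charSpan K := by
  have hfin := ContinuousLinearMap.finite_dimensional_eigenspace
    (isCompactOperator_convLp μ k) a ha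
  let ι : convEigenspace μ k a →ₗ[ℂ] Module.End.eigenspace (convLp μ k).toLinearMap a :=
    ((ContinuousMap.toLp 2 μ ℂ).toLinearMap.domRestrict (convEigenspace μ k a)).codRestrict _
      (fun f => by
        rw [Module.End.mem_eigenspace_iff]
        change ContinuousMap.toLp 2 μ ℂ (convL μ k (ContinuousMap.toLp 2 μ ℂ f.1)) = _
        rw [(mem_convEigenspace μ k a f.1).1 f.2, map_smul]
        rfl)
  have hι : Function.Injective ι := fun f g h =>
    Subtype.ext (ContinuousMap.toLp_injective μ (congrArg Subtype.val h))
  have := FiniteDimensional.of_injective ι hι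
  refine le_charSpan μ _ fun y f hf => ?_
  rw [mem_convEigenspace] at hf ⊢
  rw [convL_toLp_translate μ k hk, hf, map_smul]

/-- Eigenvectors span a dense subspace of `L²` by the spectral theorem. Since `convL` is continuous
from `L²` to the sup norm, it turns `L²` approximation into uniform approximation. -/
theorem convL_mem_closure_charSpan (k : C(K, ℂ)) (hk : ∀ x, starRingEnd ℂ (k x) = k x)
    (hk' : ∀ x, k (-x) = k x) (v : Lp ℂ 2 μ) :
    convL μ k v ∈ (charSpan K).topologicalClosure := by
  let S : Submodule ℂ (Lp ℂ 2 μ) := ⨆ a, Module.End.eigenspace (convLp μ k).toLinearMap a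
  have hS : S ≤ (charSpan K).comap (convL μ k).toLinearMap := by
    refine iSup_le fun a u hu => ?_
    rw [Module.End.mem_eigenspace_iff] at hu
    change ContinuousMap.toLp 2 μ ℂ (convL μ k u) = a • u at hu
    change convL μ k u ∈ charSpan K
    by_cases ha : a = 0
    · rw [ha, zero_smul] at hu
      rw [ContinuousMap.toLp_injective μ (hu.trans (map_zero _).symm)]
      exact (charSpan K).zero_mem
    -- The eigenvector `u` is only an `L²` class, but `convL μ k u` is a continuous representative
    -- of `a • u`, hence a continuous eigenfunction.
    · apply convEigenspace_le_charSpan μ k hk ha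
      rw [mem_convEigenspace, hu, map_smul]
  have hbot := ContinuousLinearMap.orthogonalComplement_iSup_eigenspaces_eq_bot
    (isCompactOperator_convLp μ k) (isSymmetric_convLp μ k hk hk')
  have htop : S.topologicalClosure = ⊤ :=
    (Submodule.topologicalClosure_eq_top_iff).2 hbot
  have hv : v ∈ closure (S : Set (Lp ℂ 2 μ)) := by
    rw [← Submodule.topologicalClosure_coe, htop]; trivial
  exact map_mem_closure (convL μ k).continuous hv hS

theorem topologicalClosure_charSpan_eq_top (K : Type*) [NormedAddCommGroup K] [CompactSpace K] :
    (charSpan K).topologicalClosure = ⊤ := by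
  borelize K
  let μ : Measure K := Measure.addHaar
  refine eq_top_iff.2 fun f _ => ?_
  change f ∈ closure (charSpan K : Set C(K, ℂ))
  rw [← closure_closure, Metric.mem_closure_iff]
  intro ε hε
  obtain ⟨δ, hδ, h⟩ := Metric.uniformContinuous_iff.1
    (CompactSpace.uniformContinuous_of_continuous f.continuous) (ε / 2) (by positivity)
  -- A tent supported in the `δ`-ball; divided by its integral it is an approximate identity.
  let k : C(K, ℝ) := ⟨fun x => max (δ - ‖x‖) 0, by fun_prop⟩
  let k' : C(K, ℂ) := ⟨fun x => (k x : ℂ), by fun_prop⟩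
  have hk0 : ∀ x, 0 ≤ k x := fun x => le_max_right _ _
  have hkint : Integrable k μ :=
    k.continuous.integrable_of_hasCompactSupport (HasCompactSupport.of_compactSpace _)
  have hm : 0 < ∫ x, k x ∂μ := by
    refine k.continuous.integral_pos_of_hasCompactSupport_nonneg_nonzero
      (HasCompactSupport.of_compactSpace _) hk0 (x := 0) ?_
    simp [k, hδ]
  set m := ∫ x, k x ∂μ with hmdef
  have hconj : ∀ x, starRingEnd ℂ (k' x) = k' x := fun x => Complex.conj_ofReal _
  have hsymm : ∀ x, k' (-x) = k' x := fun x => by simp [k', k]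
  let g := convL μ k' (ContinuousMap.toLp 2 μ ℂ f)
  refine ⟨(m : ℂ)⁻¹ • g, ((charSpan K).topologicalClosure).smul_mem _
    (convL_mem_closure_charSpan μ k' hconj hsymm _), ?_⟩
  refine lt_of_le_of_lt ?_ (half_lt_self hε)
  rw [ContinuousMap.dist_le (by positivity)]
  intro x
  have hg : g x = ∫ y, f (x - y) * (k y : ℂ) ∂μ := by
    rw [convL_toLp μ k' hconj, ← integral_sub_left_eq_self _ μ x]
    simp [k']
  have hmC : (m : ℂ) ≠ 0 := Complex.ofReal_ne_zero.2 hm.ne'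
  have hfx : f x = (m : ℂ)⁻¹ * ∫ y, f x * (k y : ℂ) ∂μ := by
    rw [integral_const_mul, integral_complex_ofReal, ← hmdef]
    field_simp
  rw [dist_eq_norm, ContinuousMap.smul_apply, hg, smul_eq_mul]
  nth_rw 1 [hfx]
  have hint₁ : Integrable (fun y => f x * (k y : ℂ)) μ :=
    integrable_continuousMap μ ⟨fun y => f x * (k y : ℂ), by fun_prop⟩
  have hint₂ : Integrable (fun y => f (x - y) * (k y : ℂ)) μ :=
    integrable_continuousMap μ ⟨fun y => f (x - y) * (k y : ℂ), by fun_prop⟩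
  rw [← mul_sub, ← integral_sub hint₁ hint₂,
    norm_mul, norm_inv, Complex.norm_real, Real.norm_of_nonneg hm.le, inv_mul_le_iff₀ hm]
  calc ‖∫ y, f x * (k y : ℂ) - f (x - y) * (k y : ℂ) ∂μ‖
      ≤ ∫ y, ε / 2 * k y ∂μ := by
        refine norm_integral_le_of_norm_le (hkint.const_mul _) (Eventually.of_forall fun y => ?_)
        rw [← sub_mul, norm_mul, Complex.norm_real, Real.norm_of_nonneg (hk0 y)]
        by_cases hy : ‖y‖ < δ
        · refine mul_le_mul_of_nonneg_right ?_ (hk0 y)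
          rw [← dist_eq_norm]
          refine (h ?_).le
          rw [dist_eq_norm]
          simpa using hy
        · have : k y = 0 := max_eq_right (by linarith)
          simp [this]
    _ = m * (ε / 2) := by rw [integral_const_mul, mul_comm]

end Density

/-! ### Continuous characters of the line -/

section RealCharacters

open MeasureTheory Filter Topology

/-- Integrating the functional equation over an interval where the integral of `g` is nonzero
expresses `g` by its primitive. So `g` is differentiable and solves `g' = a g`. -/
theorem exists_eq_exp_of_continuous_of_map_add {g : ℝ → ℂ} (hg : Continuous g) (h0 : g 0 = 1)
    (hadd : ∀ s t, g (s + t) = g s * g t) : ∃ a : ℂ, ∀ t : ℝ, g t = Complex.exp (a * t) := by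
  let G : ℝ → ℂ := fun t => ∫ s in (0 : ℝ)..t, g s
  have hG : ∀ t, HasDerivAt G (g t) t := fun t =>
    intervalIntegral.integral_hasDerivAt_right (hg.intervalIntegrable _ _)
      hg.stronglyMeasurable.stronglyMeasurableAtFilter hg.continuousAt
  obtain ⟨δ, hδ⟩ : ∃ δ, G δ ≠ 0 := by
    by_contra! h
    have h1 : G = fun _ => 0 := funext h
    have h2 := hG 0
    rw [h1, h0] at h2
    exact zero_ne_one ((hasDerivAt_const (0 : ℝ) (0 : ℂ)).unique h2)
  have hshift : ∀ t, g t = (G (t + δ) - G t) / G δ := fun t => by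
    rw [eq_div_iff hδ]
    have h1 : G (t + δ) - G t = ∫ s in t..(t + δ), g s :=
      intervalIntegral.integral_interval_sub_left (hg.intervalIntegrable _ _)
        (hg.intervalIntegrable _ _)
    have h2 : ∫ s in t..(t + δ), g s = ∫ s in (0 : ℝ)..δ, g (t + s) := by
      rw [intervalIntegral.integral_comp_add_left (fun s => g s) t, add_zero]
    rw [h1, h2]
    simp_rw [hadd]
    rw [intervalIntegral.integral_const_mul]
  let a : ℂ := (g δ - 1) / G δ
  have hderiv : ∀ t, HasDerivAt g (a * g t) t := fun t => by
    have h1 : HasDerivAt (fun t => (G (t + δ) - G t) / G δ) ((g (t + δ) - g t) / G δ) t :=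
      (((hG (t + δ)).comp_add_const t δ).sub (hG t)).div_const _
    rw [← funext hshift] at h1
    convert! h1 using 1
    rw [hadd]
    simp only [a]
    ring
  refine ⟨a, fun t => ?_⟩
  have hconst : ∀ t : ℝ, HasDerivAt (fun t : ℝ => g t * Complex.exp (-(a * t))) 0 t := fun t => by
    have h1 : HasDerivAt (fun t : ℝ => -(a * (t : ℂ))) (-(a * 1)) t :=
      ((hasDerivAt_id t).ofReal_comp.const_mul a).neg
    convert! (hderiv t).mul h1.cexp using 1
    ring
  have h2 := is_const_of_deriv_eq_zero (fun t => (hconst t).differentiableAt)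
    (fun t => (hconst t).deriv) t 0
  simp only [h0, Complex.ofReal_zero, mul_zero, neg_zero, Complex.exp_zero, mul_one] at h2
  rw [Complex.exp_neg, ← div_eq_mul_inv, div_eq_one_iff_eq (Complex.exp_ne_zero _)] at h2
  exact h2

theorem exists_eq_exp_I_mul {g : ℝ → ℂ} (hg : Continuous g) (h0 : g 0 = 1)
    (hadd : ∀ s t, g (s + t) = g s * g t) (hnorm : ∀ t, ‖g t‖ = 1) :
    ∃ r : ℝ, ∀ t : ℝ, g t = Complex.exp (Complex.I * r * t) := by
  obtain ⟨a, ha⟩ := exists_eq_exp_of_continuous_of_map_add hg h0 hadd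
  have hre : a.re = 0 := by
    have h1 := hnorm 1
    rw [ha, Complex.norm_exp, Real.exp_eq_one_iff] at h1
    simpa using h1
  refine ⟨a.im, fun t => ?_⟩
  have : a = Complex.I * a.im := by
    apply Complex.ext <;> simp [hre]
  rw [ha, ← this]

end RealCharacters

/-! ### Almost periods of either sign, and Bochner-type precompactness -/

section Shift

open Filter Topology

variable {X : Type*} [NormedAddCommGroup X] {I : Set ℝ}

/-- `s` is an `ε`-period (of arbitrary sign) of `f : I → X`. -/
def ShiftClose (f : I → X) (ε s : ℝ) : Prop :=
  ∀ t t' : I, (t' : ℝ) = t + s → ‖f t' - f t‖ ≤ ε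

theorem ShiftClose.mono {f : I → X} {ε ε' s : ℝ} (h : ShiftClose f ε s) (hε : ε ≤ ε') :
    ShiftClose f ε' s := fun t t' ht => (h t t' ht).trans hε

theorem ShiftClose.neg {f : I → X} {ε s : ℝ} (h : ShiftClose f ε s) : ShiftClose f ε (-s) :=
  fun t t' ht => by
    rw [norm_sub_rev]
    exact h t' t (by linarith)

theorem shiftClose_zero (f : I → X) {ε : ℝ} (hε : 0 ≤ ε) : ShiftClose f ε 0 := fun t t' ht => by
  have : t' = t := Subtype.ext (by simpa using ht)
  simpa [this] using hε

theorem add_mem_of_nonneg (hI : I = Set.univ ∨ I = Set.Ici 0) {t s : ℝ} (ht : t ∈ I)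
    (hs : 0 ≤ s) : t + s ∈ I := by
  rcases hI with rfl | rfl
  · trivial
  · exact add_nonneg ht hs

theorem mem_of_nonneg (hI : I = Set.univ ∨ I = Set.Ici 0) {t : ℝ} (ht : 0 ≤ t) : t ∈ I := by
  rcases hI with rfl | rfl
  · trivial
  · exact ht

theorem isClosed_of_eq (hI : I = Set.univ ∨ I = Set.Ici 0) : IsClosed I := by
  rcases hI with rfl | rfl
  · exact isClosed_univ
  · exact isClosed_Ici

theorem ShiftClose.add (hI : I = Set.univ ∨ I = Set.Ici 0) {f : I → X} {ε ε' s s' : ℝ}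
    (h : ShiftClose f ε s) (h' : ShiftClose f ε' s') : ShiftClose f (ε + ε') (s + s') := by
  intro t t' ht
  -- On the half-line an intermediate point may leave `I`, but performing the two shifts in one of
  -- the two orders keeps it inside.
  have hmem : (t : ℝ) + s ∈ I ∨ (t : ℝ) + s' ∈ I := by
    rcases le_total 0 s with hs | hs
    · exact Or.inl (add_mem_of_nonneg hI t.2 hs)
    rcases le_total 0 s' with hs' | hs'
    · exact Or.inr (add_mem_of_nonneg hI t.2 hs')
    · left
      have := add_mem_of_nonneg hI t'.2 (s := -s') (by linarith)
      rwa [ht, show (t : ℝ) + (s + s') + -s' = t + s by ring] at this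
  rcases hmem with hm | hm
  · have h1 := h t ⟨_, hm⟩ rfl
    have h2 := h' ⟨_, hm⟩ t' (by rw [ht]; ring)
    calc ‖f t' - f t‖ = ‖(f t' - f ⟨_, hm⟩) + (f ⟨_, hm⟩ - f t)‖ := by rw [sub_add_sub_cancel]
      _ ≤ _ := norm_add_le _ _
      _ ≤ _ := by linarith
  · have h1 := h' t ⟨_, hm⟩ rfl
    have h2 := h ⟨_, hm⟩ t' (by rw [ht]; ring)
    calc ‖f t' - f t‖ = ‖(f t' - f ⟨_, hm⟩) + (f ⟨_, hm⟩ - f t)‖ := by rw [sub_add_sub_cancel]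
      _ ≤ _ := norm_add_le _ _
      _ ≤ _ := by linarith

theorem ShiftClose.sub (hI : I = Set.univ ∨ I = Set.Ici 0) {f : I → X} {ε ε' s s' : ℝ}
    (h : ShiftClose f ε s) (h' : ShiftClose f ε' s') : ShiftClose f (ε + ε') (s - s') := by
  rw [sub_eq_add_neg]
  exact h.add hI h'.neg

theorem exists_shiftClose_add_mem_Icc {f : I → X} {ε : ℝ} (hε : 0 ≤ ε)
    (h : RelativelyDense {τ | 0 < τ ∧ ShiftClose f ε τ}) :
    ∃ l : ℝ, 0 < l ∧ ∀ t : ℝ, ∃ σ, ShiftClose f ε σ ∧ t + σ ∈ Set.Icc 0 l := by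
  obtain ⟨l, hl, h⟩ := h
  refine ⟨l, hl, fun t => ?_⟩
  rcases lt_or_ge t 0 with ht | ht
  · obtain ⟨τ, hτ, h1, h2⟩ := h (-t) (by linarith)
    exact ⟨τ, hτ.2, by linarith, by linarith⟩
  rcases le_or_gt t l with ht' | ht'
  · exact ⟨0, shiftClose_zero f hε, by linarith, by linarith⟩
  · obtain ⟨τ, hτ, h1, h2⟩ := h (t - l) (by linarith)
    exact ⟨-τ, hτ.2.neg, by linarith, by linarith⟩

theorem isCompact_preimage_Icc (hI : I = Set.univ ∨ I = Set.Ici 0) (a b : ℝ) :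
    IsCompact ((↑) ⁻¹' Set.Icc a b : Set I) :=
  (isClosed_of_eq hI).isClosedEmbedding_subtypeVal.isCompact_preimage isCompact_Icc

theorem exists_norm_le_of_relativelyDense (hI : I = Set.univ ∨ I = Set.Ici 0) {f : I → X}
    (hf : Continuous f) (h : RelativelyDense {τ | 0 < τ ∧ ShiftClose f 1 τ}) :
    ∃ M, ∀ t, ‖f t‖ ≤ M := by
  obtain ⟨l, hl, h⟩ := exists_shiftClose_add_mem_Icc zero_le_one h
  obtain ⟨M, hM⟩ := (isCompact_preimage_Icc hI 0 l).exists_bound_of_continuousOn hf.continuousOn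
  refine ⟨M + 1, fun t => ?_⟩
  obtain ⟨σ, hσ, hmem⟩ := h t
  have h1 := hM ⟨_, mem_of_nonneg hI hmem.1⟩ hmem
  have h2 := hσ t ⟨_, mem_of_nonneg hI hmem.1⟩ rfl
  rw [norm_sub_rev] at h2
  have h3 := norm_le_norm_add_norm_sub' (f t) (f ⟨_, mem_of_nonneg hI hmem.1⟩)
  linarith

/-- Almost periodicity, expressed through `ShiftClose`. -/
def IsAlmostPeriodic (f : I → X) : Prop :=
  Continuous f ∧ ∀ ε : ℝ, 0 < ε → RelativelyDense {τ | 0 < τ ∧ ShiftClose f ε τ}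

/-- Uniform continuity: an almost period moves both points into `[0, l + 1]`, the extra `1` leaving
room for the shift `s < 1`. -/
theorem IsAlmostPeriodic.exists_shiftClose_of_abs_lt (hI : I = Set.univ ∨ I = Set.Ici 0)
    {f : I → X} (hf : IsAlmostPeriodic f) {ε : ℝ} (hε : 0 < ε) :
    ∃ δ > 0, ∀ s, |s| < δ → ShiftClose f ε s := by
  obtain ⟨l, hl, h⟩ := exists_shiftClose_add_mem_Icc (by positivity) (hf.2 (ε / 3) (by positivity))
  obtain ⟨δ, hδ, hu⟩ := Metric.uniformContinuousOn_iff.1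
    ((isCompact_preimage_Icc hI 0 (l + 1)).uniformContinuousOn_of_continuous hf.1.continuousOn)
    (ε / 3) (by positivity)
  have key : ∀ s, 0 ≤ s → s < min δ 1 → ShiftClose f ε s := by
    intro s hs hsδ t t' ht
    obtain ⟨σ, hσ, hmem⟩ := h t
    have hsd := lt_min_iff.1 hsδ
    have hu' : (t' : ℝ) + σ ∈ Set.Icc 0 (l + 1) := by
      constructor <;> linarith [hmem.1, hmem.2, hsd.2]
    have hm := mem_of_nonneg hI hmem.1
    have hm' := mem_of_nonneg hI hu'.1
    have h1 := hσ t ⟨_, hm⟩ rfl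
    have h2 := hσ t' ⟨_, hm'⟩ rfl
    have h3 := hu ⟨_, hm'⟩ hu' ⟨_, hm⟩ ⟨hmem.1, by linarith [hmem.2]⟩ (by
      rw [Subtype.dist_eq, Real.dist_eq]
      simp only [ht]
      rw [show (t : ℝ) + s + σ - (t + σ) = s by ring, abs_of_nonneg hs]
      exact hsd.1)
    rw [dist_eq_norm] at h3
    rw [norm_sub_rev] at h2
    calc ‖f t' - f t‖ = ‖(f t' - f ⟨_, hm'⟩) + (f ⟨_, hm'⟩ - f ⟨_, hm⟩) + (f ⟨_, hm⟩ - f t)‖ := by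
          congr 1; abel
      _ ≤ _ := norm_add₃_le
      _ ≤ ε := by linarith
  refine ⟨min δ 1, by positivity, fun s hs => ?_⟩
  rcases le_total 0 s with h0 | h0
  · exact key s h0 (by rwa [abs_of_nonneg h0] at hs)
  · have := (key (-s) (by linarith) (by rwa [abs_of_nonpos h0] at hs)).neg
    rwa [neg_neg] at this

/-- The `ε`-periods of `f` cover the line by finitely many of their translates. -/
def IsShiftPrecompact (f : I → X) : Prop :=
  ∀ ε : ℝ, 0 < ε → ∃ F : Finset ℝ, ∀ s, ∃ a ∈ F, ShiftClose f ε (s - a)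

theorem IsAlmostPeriodic.isShiftPrecompact (hI : I = Set.univ ∨ I = Set.Ici 0)
    {f : I → X} (hf : IsAlmostPeriodic f) : IsShiftPrecompact f := by
  intro ε hε
  obtain ⟨l, hl, h⟩ := exists_shiftClose_add_mem_Icc (by positivity) (hf.2 (ε / 2) (by positivity))
  obtain ⟨δ, hδ, hu⟩ := hf.exists_shiftClose_of_abs_lt hI (half_pos hε)
  obtain ⟨F, hF, hcov⟩ := Metric.totallyBounded_iff.1
    (isCompact_Icc (a := (0 : ℝ)) (b := l)).totallyBounded δ hδ
  refine ⟨hF.toFinset, fun s => ?_⟩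
  obtain ⟨σ, hσ, hmem⟩ := h s
  obtain ⟨a, ha, hd⟩ := Set.mem_iUnion₂.1 (hcov hmem)
  refine ⟨a, hF.mem_toFinset.2 ha, ?_⟩
  have := (hu (s + σ - a) (by simpa [Real.dist_eq] using hd)).sub hI hσ
  rw [show s + σ - a - σ = s - a by ring] at this
  exact this.mono (by linarith)

/-- The covering form, unlike relative density, passes readily to sums. -/
theorem isAlmostPeriodic_iff (hI : I = Set.univ ∨ I = Set.Ici 0) (f : I → X) :
    IsAlmostPeriodic f ↔ Continuous f ∧ IsShiftPrecompact f := by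
  refine ⟨fun hf => ⟨hf.1, hf.isShiftPrecompact hI⟩, fun hf => ⟨hf.1, fun ε hε => ?_⟩⟩
  obtain ⟨F, hF⟩ := hf.2 ε hε
  obtain ⟨B, hB⟩ := F.finite_toSet.isBounded.exists_norm_le
  have hB' : ∀ a ∈ F, -B ≤ a ∧ a ≤ B := fun a ha => abs_le.1 (by simpa using hB a ha)
  have hB0 : 0 ≤ B := by
    obtain ⟨a, ha, _⟩ := hF 0
    linarith [hB' a ha]
  refine ⟨2 * B + 1, by linarith, fun a ha => ?_⟩
  obtain ⟨b, hb, h⟩ := hF (a + B + 1)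
  have := hB' b hb
  exact ⟨_, ⟨by linarith, h⟩, by linarith, by linarith⟩

theorem IsShiftPrecompact.add (hI : I = Set.univ ∨ I = Set.Ici 0) {f g : I → X}
    (hf : IsShiftPrecompact f) (hg : IsShiftPrecompact g) : IsShiftPrecompact (f + g) := by
  classical
  intro ε hε
  obtain ⟨F, hF⟩ := hf (ε / 4) (by positivity)
  obtain ⟨G, hG⟩ := hg (ε / 4) (by positivity)
  -- One representative `r (a, b)` is fixed for each cell of the common refinement of the two
  -- covers; within a cell, `s - r (a, b)` is an almost period of both functions. Values on empty
  -- cells are never used.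
  let P : ℝ × ℝ → ℝ → Prop := fun p s =>
    ShiftClose f (ε / 4) (s - p.1) ∧ ShiftClose g (ε / 4) (s - p.2)
  let r : ℝ × ℝ → ℝ := fun p => Classical.epsilon (P p)
  refine ⟨(F ×ˢ G).image r, fun s => ?_⟩
  obtain ⟨a, ha, hsa⟩ := hF s
  obtain ⟨b, hb, hsb⟩ := hG s
  have hr : P (a, b) (r (a, b)) := Classical.epsilon_spec (p := P (a, b)) ⟨s, hsa, hsb⟩
  refine ⟨r (a, b), Finset.mem_image_of_mem _ (Finset.mk_mem_product ha hb), ?_⟩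
  have h1 := hsa.sub hI hr.1
  have h2 := hsb.sub hI hr.2
  simp only [sub_sub_sub_cancel_right] at h1 h2
  intro t t' ht
  have h3 := h1 t t' ht
  have h4 := h2 t t' ht
  calc ‖(f + g) t' - (f + g) t‖ = ‖(f t' - f t) + (g t' - g t)‖ := by
        simp only [Pi.add_apply]; congr 1; abel
    _ ≤ _ := norm_add_le _ _
    _ ≤ ε := by linarith

theorem IsAlmostPeriodic.add (hI : I = Set.univ ∨ I = Set.Ici 0) {f g : I → X}
    (hf : IsAlmostPeriodic f) (hg : IsAlmostPeriodic g) : IsAlmostPeriodic (f + g) :=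
  (isAlmostPeriodic_iff hI _).2 ⟨hf.1.add hg.1,
    (hf.isShiftPrecompact hI).add hI (hg.isShiftPrecompact hI)⟩

theorem RelativelyDense.mono {S T : Set ℝ} (h : RelativelyDense S) (hST : S ⊆ T) :
    RelativelyDense T := by
  obtain ⟨l, hl, h⟩ := h
  exact ⟨l, hl, fun a ha => let ⟨τ, hτ, h'⟩ := h a ha; ⟨τ, hST hτ, h'⟩⟩

theorem IsAlmostPeriodic.smul [NormedSpace ℂ X] {f : I → X}
    (hf : IsAlmostPeriodic f) (a : ℂ) : IsAlmostPeriodic (a • f) := by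
  refine ⟨hf.1.const_smul a, fun ε hε => (hf.2 (ε / (‖a‖ + 1)) (by positivity)).mono ?_⟩
  rintro τ ⟨hτ, h⟩
  refine ⟨hτ, fun t t' ht => ?_⟩
  have h1 := h t t' ht
  rw [le_div_iff₀ (by positivity)] at h1
  calc ‖(a • f) t' - (a • f) t‖ = ‖a‖ * ‖f t' - f t‖ := by
        rw [Pi.smul_apply, Pi.smul_apply, ← smul_sub, norm_smul]
    _ ≤ ε := by nlinarith [norm_nonneg (f t' - f t)]

end Shift

/-! ### `c`-almost periodic functions are almost periodic -/

section CAP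

variable {E : Type*} [NormedAddCommGroup E] [NormedSpace ℂ E] {I : Set ℝ}

theorem mem_AP_iff (f : I → E) : f ∈ AP I E ↔ IsAlmostPeriodic f := by
  simp only [AP, cAP, IsApproxPeriod, IsAlmostPeriodic, ShiftClose, one_smul, Set.mem_ofPred_eq]

/-- Two powers of `c` are close by compactness of the disc; divide by the smaller one, of modulus
`1`. -/
theorem exists_pow_sub_one_norm_le {c : ℂ} (hc : ‖c‖ = 1) {ε : ℝ} (hε : 0 < ε) :
    ∃ k : ℕ, 0 < k ∧ ‖c ^ k - 1‖ ≤ ε := by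
  obtain ⟨a, -, φ, hφ, ha⟩ := (isCompact_closedBall (0 : ℂ) 1).tendsto_subseq
    (x := fun n : ℕ => c ^ n) (fun n => by simp [hc])
  obtain ⟨N, hN⟩ := Metric.cauchySeq_iff'.1 ha.cauchySeq ε hε
  have h1 := hN (N + 1) (by omega)
  have h2 : φ N < φ (N + 1) := hφ (by omega)
  refine ⟨φ (N + 1) - φ N, by omega, ?_⟩
  rw [dist_eq_norm] at h1
  simp only [Function.comp_apply] at h1
  have h3 : c ^ φ (N + 1) - c ^ φ N = c ^ φ N * (c ^ (φ (N + 1) - φ N) - 1) := by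
    rw [mul_sub, ← pow_add, mul_one, Nat.add_sub_cancel' h2.le]
  rw [h3, norm_mul, norm_pow, hc, one_pow, one_mul] at h1
  exact h1.le

variable {c : ℂ} {f : I → E}

theorem exists_norm_le_of_mem_cAP (hI : I = Set.univ ∨ I = Set.Ici 0) (hc : ‖c‖ = 1)
    (hf : f ∈ cAP c I E) : ∃ M, ∀ t, ‖f t‖ ≤ M := by
  obtain ⟨M, hM⟩ := exists_norm_le_of_relativelyDense hI (f := fun t => ‖f t‖) hf.1.norm
    ((hf.2 1 one_pos).mono fun τ hτ => ⟨hτ.1, fun t t' ht => by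
      have h1 := hτ.2 t t' ht
      have h2 := abs_norm_sub_norm_le (f t') (c • f t)
      rw [norm_smul, hc, one_mul] at h2
      exact h2.trans h1⟩)
  exact ⟨M, fun t => by simpa using hM t⟩

theorem IsApproxPeriod.nsmul (hI : I = Set.univ ∨ I = Set.Ici 0) (hc : ‖c‖ = 1) {ε τ : ℝ}
    (h : IsApproxPeriod f c ε τ) (k : ℕ) (t s : I) (hs : (s : ℝ) = t + k * τ) :
    ‖f s - c ^ k • f t‖ ≤ k * ε := by
  induction k generalizing s with
  | zero =>
    have : s = t := Subtype.ext (by simpa using hs)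
    simp [this]
  | succ k ih =>
    have hm : (t : ℝ) + k * τ ∈ I :=
      add_mem_of_nonneg hI t.2 (mul_nonneg (Nat.cast_nonneg k) h.1.le)
    have h1 := ih ⟨_, hm⟩ rfl
    have h2 := h.2 ⟨_, hm⟩ s (by rw [hs]; push_cast; ring)
    calc ‖f s - c ^ (k + 1) • f t‖
        = ‖(f s - c • f ⟨_, hm⟩) + c • (f ⟨_, hm⟩ - c ^ k • f t)‖ := by
          rw [smul_sub, sub_add_sub_cancel, smul_smul, pow_succ']
      _ ≤ _ := norm_add_le _ _
      _ = ‖f s - c • f ⟨_, hm⟩‖ + ‖f ⟨_, hm⟩ - c ^ k • f t‖ := by rw [norm_smul, hc, one_mul]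
      _ ≤ _ := by push_cast; linarith

theorem cAP_subset_AP (hI : I = Set.univ ∨ I = Set.Ici 0) (hc : ‖c‖ = 1) :
    cAP c I E ⊆ AP I E := by
  intro f hf
  rw [mem_AP_iff]
  refine ⟨hf.1, fun ε hε => ?_⟩
  obtain ⟨M, hM⟩ := exists_norm_le_of_mem_cAP hI hc hf
  have hM0 : 0 ≤ M := (norm_nonneg _).trans (hM ⟨0, mem_of_nonneg hI le_rfl⟩)
  obtain ⟨k, hk, hck⟩ := exists_pow_sub_one_norm_le hc (ε := ε / 2 / (M + 1)) (by positivity)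
  have hk' : (0 : ℝ) < k := Nat.cast_pos.2 hk
  -- The error of a `c`-period accumulates `k` times along `k * τ`; the other `ε / 2` pays for
  -- replacing `c ^ k` by `1`.
  obtain ⟨l, hl, h⟩ := hf.2 (ε / 2 / k) (by positivity)
  refine ⟨k * l, by positivity, fun a ha => ?_⟩
  obtain ⟨τ, hτ, h1, h2⟩ := h (a / k) (by positivity)
  rw [div_le_iff₀ hk'] at h1
  refine ⟨k * τ, ⟨mul_pos hk' hτ.1, fun t s hs => ?_⟩, by linarith, ?_⟩
  · have h3 := hτ.nsmul hI hc k t s hs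
    rw [mul_div_cancel₀ _ hk'.ne'] at h3
    rw [le_div_iff₀ (by positivity)] at hck
    calc ‖f s - f t‖ = ‖(f s - c ^ k • f t) + (c ^ k - 1) • f t‖ := by
          rw [sub_smul, one_smul, sub_add_sub_cancel]
      _ ≤ _ := norm_add_le _ _
      _ = ‖f s - c ^ k • f t‖ + ‖c ^ k - 1‖ * ‖f t‖ := by rw [norm_smul]
      _ ≤ ε := by nlinarith [hM t, norm_nonneg (c ^ k - 1)]
  · calc k * τ ≤ k * (a / k + l) := by gcongr
      _ = a + k * l := by field_simp

theorem cAPSpan_subset_AP (hI : I = Set.univ ∨ I = Set.Ici 0) (hc : ‖c‖ = 1) :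
    (cAPSpan c I E : Set (I → E)) ⊆ AP I E := by
  intro f hf
  refine Submodule.span_induction (p := fun f _ => f ∈ AP I E)
    (fun f hf => cAP_subset_AP hI hc hf) ?_ (fun f g _ _ hf hg => ?_) (fun a f _ hf => ?_) hf
  · rw [mem_AP_iff]
    exact ⟨continuous_const, fun ε hε => ⟨1, one_pos, fun a ha =>
      ⟨a + 1, ⟨by linarith, fun t t' _ => by simpa using hε.le⟩, by linarith, le_rfl⟩⟩⟩
  · rw [mem_AP_iff] at *
    exact hf.add hI hg
  · rw [mem_AP_iff] at *
    exact hf.smul a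

end CAP

universe u

/-! ### The compact group attached to an almost periodic function -/

section GroupCompletion

open Filter Topology

/-- A group seminorm is induced by a dense homomorphism into a complete normed group. -/
theorem exists_denseRange_addMonoidHom {A : Type u} [AddCommGroup A] (p : AddGroupSeminorm A) :
    ∃ (K : Type u) (_ : NormedAddCommGroup K) (_ : CompleteSpace K) (φ : A →+ K),
      DenseRange φ ∧ ∀ a, ‖φ a‖ = p a := by
  let := p.toSeminormedAddCommGroup
  exact ⟨UniformSpace.Completion A, inferInstance, inferInstance,
    UniformSpace.Completion.toCompl, UniformSpace.Completion.denseRange_coe,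
    fun a => UniformSpace.Completion.norm_coe a⟩

variable {X : Type*} [NormedAddCommGroup X] {I : Set ℝ}

theorem IsAlmostPeriodic.exists_norm_le (hI : I = Set.univ ∨ I = Set.Ici 0) {f : I → X}
    (hf : IsAlmostPeriodic f) : ∃ M, ∀ t, ‖f t‖ ≤ M :=
  exists_norm_le_of_relativelyDense hI hf.1 (hf.2 1 one_pos)

/-- The best constant `ε` for which `s` is an `ε`-period. -/
noncomputable def shiftNorm (f : I → X) (s : ℝ) : ℝ :=
  sInf {ε | 0 ≤ ε ∧ ShiftClose f ε s}

theorem shiftNorm_nonneg (f : I → X) (s : ℝ) : 0 ≤ shiftNorm f s :=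
  Real.sInf_nonneg fun _ h => h.1

theorem shiftNorm_le {f : I → X} {ε s : ℝ} (hε : 0 ≤ ε) (h : ShiftClose f ε s) :
    shiftNorm f s ≤ ε :=
  csInf_le ⟨0, fun _ h => h.1⟩ ⟨hε, h⟩

/-- The infimum is attained. Boundedness of `f` makes the set nonempty, which excludes the default
value `sInf ∅ = 0`. -/
theorem shiftClose_shiftNorm {f : I → X} {M : ℝ} (hM : ∀ t, ‖f t‖ ≤ M) (s : ℝ) :
    ShiftClose f (shiftNorm f s) s := fun t t' ht =>
  le_csInf ⟨M + M, by linarith [norm_nonneg (f t), hM t], fun t t' _ =>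
    (norm_sub_le _ _).trans (add_le_add (hM t') (hM t))⟩ fun _ h => h.2 t t' ht

/-- `shiftNorm` as a group seminorm. -/
noncomputable def shiftSeminorm (hI : I = Set.univ ∨ I = Set.Ici 0) (f : I → X) {M : ℝ}
    (hM : ∀ t, ‖f t‖ ≤ M) : AddGroupSeminorm ℝ where
  toFun := shiftNorm f
  map_zero' := le_antisymm (shiftNorm_le le_rfl (shiftClose_zero f le_rfl)) (shiftNorm_nonneg _ _)
  add_le' s t := shiftNorm_le (add_nonneg (shiftNorm_nonneg _ _) (shiftNorm_nonneg _ _))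
    ((shiftClose_shiftNorm hM s).add hI (shiftClose_shiftNorm hM t))
  neg' s := le_antisymm (shiftNorm_le (shiftNorm_nonneg _ _) (shiftClose_shiftNorm hM s).neg)
    (shiftNorm_le (shiftNorm_nonneg _ _) (by
      have := (shiftClose_shiftNorm hM (-s)).neg
      rwa [neg_neg] at this))

/-- The compact group generated by the translates of an almost periodic function. -/
theorem IsAlmostPeriodic.exists_compact_group (hI : I = Set.univ ∨ I = Set.Ici 0) {f : I → X}
    (hf : IsAlmostPeriodic f) :
    ∃ (K : Type) (_ : NormedAddCommGroup K) (_ : CompactSpace K) (φ : ℝ →+ K),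
      Continuous φ ∧ DenseRange φ ∧ (∀ s, ShiftClose f ‖φ s‖ s) ∧
      ∀ s ε, 0 ≤ ε → ShiftClose f ε s → ‖φ s‖ ≤ ε := by
  obtain ⟨M, hM⟩ := hf.exists_norm_le hI
  obtain ⟨K, _, _, φ, hd, hφ⟩ := exists_denseRange_addMonoidHom (shiftSeminorm hI f hM)
  have hφ' : ∀ s, ‖φ s‖ = shiftNorm f s := hφ
  have hle : ∀ s ε, 0 ≤ ε → ShiftClose f ε s → ‖φ s‖ ≤ ε := fun s ε hε h => by
    rw [hφ']
    exact shiftNorm_le hε h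
  refine ⟨K, inferInstance, ?_, φ, ?_, hd, fun s => ?_, hle⟩
  -- Finite covers by almost periods are finite nets for the image of `ℝ`, which is dense in the
  -- complete group `K`.
  · have htb : TotallyBounded (Set.range φ) := by
      rw [Metric.totallyBounded_iff]
      intro ε hε
      obtain ⟨F, hF⟩ := hf.isShiftPrecompact hI (ε / 2) (by positivity)
      refine ⟨φ '' F, F.finite_toSet.image _, ?_⟩
      rintro _ ⟨s, rfl⟩
      obtain ⟨a, ha, h⟩ := hF s
      refine Set.mem_iUnion₂.2 ⟨φ a, ⟨a, ha, rfl⟩, ?_⟩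
      rw [Metric.mem_ball, dist_eq_norm, ← map_sub]
      exact (hle _ _ (by positivity) h).trans_lt (half_lt_self hε)
    have := htb.closure.isCompact_of_isClosed isClosed_closure
    rw [hd.closure_range] at this
    exact ⟨this⟩
  · refine continuous_of_continuousAt_zero φ ?_
    rw [Metric.continuousAt_iff]
    intro ε hε
    obtain ⟨δ, hδ, h⟩ := hf.exists_shiftClose_of_abs_lt hI (half_pos hε)
    refine ⟨δ, hδ, fun x hx => ?_⟩
    rw [map_zero, dist_zero_right]
    exact (hle _ _ (by positivity) (h x (by simpa using hx))).trans_lt (half_lt_self hε)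
  · rw [hφ']
    exact shiftClose_shiftNorm hM s

end GroupCompletion

/-! ### Bohr's approximation theorem -/

section Approximation

variable {E : Type*} [NormedAddCommGroup E] [NormedSpace ℂ E] {I : Set ℝ}

/-- The functions that are uniform limits of elements of `P`. -/
def uniformClosure (P : Submodule ℂ (I → E)) : Submodule ℂ (I → E) where
  carrier := {f | ∀ ε : ℝ, 0 < ε → ∃ g ∈ P, ∀ t, ‖f t - g t‖ ≤ ε}
  zero_mem' := fun ε hε => ⟨0, P.zero_mem, fun t => by simpa using hε.le⟩
  add_mem' := fun {f g} hf hg ε hε => by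
    obtain ⟨f', hf', h1⟩ := hf (ε / 2) (half_pos hε)
    obtain ⟨g', hg', h2⟩ := hg (ε / 2) (half_pos hε)
    refine ⟨f' + g', P.add_mem hf' hg', fun t => ?_⟩
    calc ‖(f + g) t - (f' + g') t‖ = ‖(f t - f' t) + (g t - g' t)‖ := by
          simp only [Pi.add_apply]; congr 1; abel
      _ ≤ _ := norm_add_le _ _
      _ ≤ ε := by linarith [h1 t, h2 t]
  smul_mem' := fun a f hf ε hε => by
    obtain ⟨g, hg, h⟩ := hf (ε / (‖a‖ + 1)) (by positivity)
    refine ⟨a • g, P.smul_mem a hg, fun t => ?_⟩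
    have h1 := h t
    rw [le_div_iff₀ (by positivity)] at h1
    rw [Pi.smul_apply, Pi.smul_apply, ← smul_sub, norm_smul]
    nlinarith [norm_nonneg (f t - g t)]

theorem mem_uniformClosure_of_forall {P : Submodule ℂ (I → E)} {f : I → E}
    (h : ∀ ε : ℝ, 0 < ε → ∃ g ∈ uniformClosure P, ∀ t, ‖f t - g t‖ ≤ ε) :
    f ∈ uniformClosure P := by
  intro ε hε
  obtain ⟨g, hg, h1⟩ := h (ε / 2) (half_pos hε)
  obtain ⟨k, hk, h2⟩ := hg (ε / 2) (half_pos hε)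
  refine ⟨k, hk, fun t => ?_⟩
  calc ‖f t - k t‖ = ‖(f t - g t) + (g t - k t)‖ := by rw [sub_add_sub_cancel]
    _ ≤ _ := norm_add_le _ _
    _ ≤ ε := by linarith [h1 t, h2 t]

/-- The function `t ↦ e^{irt} a`. -/
noncomputable def expFun (I : Set ℝ) (r : ℝ) (a : E) : I → E :=
  fun t => Complex.exp (Complex.I * r * (t : ℝ)) • a

/-- Trigonometric polynomials with frequencies in `Λ`. -/
noncomputable def trigSpan (Λ : Set ℝ) (I : Set ℝ) (E : Type*) [NormedAddCommGroup E]
    [NormedSpace ℂ E] : Submodule ℂ (I → E) :=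
  Submodule.span ℂ {f | ∃ r ∈ Λ, ∃ a : E, f = expFun I r a}

theorem comp_smul_mem_uniformClosure {K : Type*} [NormedAddCommGroup K] [CompactSpace K]
    {φ : ℝ →+ K} (hφ : Continuous φ) (ρ : C(K, ℂ)) (a : E) :
    (fun t : I => ρ (φ t) • a) ∈ uniformClosure (trigSpan Set.univ I E) := by
  intro ε hε
  have hρ : ρ ∈ closure (charSpan K : Set C(K, ℂ)) := by
    rw [← Submodule.topologicalClosure_coe, topologicalClosure_charSpan_eq_top]
    trivial
  obtain ⟨g, hg, hd⟩ := Metric.mem_closure_iff.1 hρ (ε / (‖a‖ + 1)) (by positivity)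
  refine ⟨fun t => g (φ t) • a, ?_, fun t => ?_⟩
  · refine Submodule.span_induction
      (p := fun (g : C(K, ℂ)) _ => (fun t : I => g (φ t) • a) ∈ trigSpan Set.univ I E)
      (fun χ hχ => ?_) ?_ (fun u v _ _ hu hv => ?_) (fun b u _ hu => ?_) hg
    · have hχ' : IsCharacter χ := hχ
      obtain ⟨r, hr⟩ := exists_eq_exp_I_mul (g := fun t => χ (φ t)) (χ.continuous.comp hφ)
        (by simpa using hχ'.1) (fun s t => by simp [hχ'.2]) (fun t => hχ'.norm_eq_one _)
      refine Submodule.subset_span ⟨r, trivial, a, ?_⟩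
      funext t
      simp only [hr, expFun]
    · convert! (trigSpan Set.univ I E).zero_mem using 1
      funext t
      simp
    · convert! (trigSpan Set.univ I E).add_mem hu hv using 1
      funext t
      simp [add_smul]
    · convert! (trigSpan Set.univ I E).smul_mem b hu using 1
      funext t
      simp [mul_smul]
  · rw [← sub_smul, norm_smul, ← dist_eq_norm]
    have h1 := (ContinuousMap.dist_apply_le_dist (f := ρ) (g := g) (φ t)).trans hd.le
    rw [le_div_iff₀ (by positivity)] at h1
    nlinarith [dist_nonneg (x := ρ (φ t)) (y := g (φ t))]

/-- **Bohr's approximation theorem** for vector-valued functions. -/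
theorem IsAlmostPeriodic.mem_uniformClosure_trigSpan (hI : I = Set.univ ∨ I = Set.Ici 0)
    {f : I → E} (hf : IsAlmostPeriodic f) : f ∈ uniformClosure (trigSpan Set.univ I E) := by
  obtain ⟨K, _, _, φ, hφ, hd, hclose, hle⟩ := hf.exists_compact_group hI
  refine mem_uniformClosure_of_forall fun ε hε => ?_
  obtain ⟨l, hl, hmem⟩ := exists_shiftClose_add_mem_Icc (by positivity)
    (hf.2 (ε / 4) (by positivity))
  obtain ⟨F, hF⟩ := hf.isShiftPrecompact hI (ε / 4) (by positivity)
  choose σ hσ hσmem using hmem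
  -- The net points `a` may lie outside `I`; an almost period brings each into `[0, l]`, so that `f
  -- (p a)` makes sense.
  let p : ℝ → I := fun a => ⟨a + σ a, mem_of_nonneg hI (hσmem a).1⟩
  let ψ : ℝ → K → ℝ := fun a x => max (ε - ‖x - φ (p a)‖) 0
  have hψc : ∀ a, Continuous (ψ a) := fun a => by fun_prop
  have hψ0 : ∀ a x, 0 ≤ ψ a x := fun a x => le_max_right _ _
  let Ψ : K → ℝ := fun x => ∑ a ∈ F, ψ a x
  have hΨc : Continuous Ψ := continuous_finsetSum _ fun a _ => hψc a
  have hΨ : ∀ x, 0 < Ψ x := by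
    have hcl : IsClosed {x | ε / 2 ≤ Ψ x} := isClosed_le continuous_const hΨc
    intro x
    -- On the dense image of `ℝ` some bump is at least `ε - (ε / 4 + ε / 4)`; closedness carries the
    -- bound to all of `K`.
    refine (half_pos hε).trans_le (hd.induction_on (p := fun x => ε / 2 ≤ Ψ x) x hcl fun s => ?_)
    obtain ⟨a, ha, hs⟩ := hF s
    refine le_trans ?_ (Finset.single_le_sum (f := fun a => ψ a (φ s)) (fun a _ => hψ0 a _) ha)
    have h1 : ‖φ (s - a - σ a)‖ ≤ ε / 4 + ε / 4 := hle _ _ (by positivity) (hs.sub hI (hσ a))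
    have h2 : φ s - φ (p a) = φ (s - a - σ a) := by
      rw [← map_sub]
      congr 1
      simp only [p]
      ring
    refine le_max_of_le_left ?_
    rw [h2]
    linarith
  let ρ : ℝ → C(K, ℂ) := fun a => ⟨fun x => ((ψ a x / Ψ x : ℝ) : ℂ),
    Complex.continuous_ofReal.comp ((hψc a).div hΨc fun x => (hΨ x).ne')⟩
  refine ⟨∑ a ∈ F, fun t : I => ρ a (φ t) • f (p a),
    Submodule.sum_mem _ fun a _ => comp_smul_mem_uniformClosure hφ (ρ a) _, fun t => ?_⟩
  have hsum : ∑ a ∈ F, ψ a (φ t) / Ψ (φ t) = 1 := by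
    rw [← Finset.sum_div]
    exact div_self (hΨ _).ne'
  have hsumC : ∑ a ∈ F, ρ a (φ t) = 1 := by
    simp only [ρ, ContinuousMap.coe_mk]
    rw [← Complex.ofReal_sum, hsum, Complex.ofReal_one]
  rw [Finset.sum_apply]
  have hft : f t = ∑ a ∈ F, ρ a (φ t) • f t := by rw [← Finset.sum_smul, hsumC, one_smul]
  calc ‖f t - ∑ a ∈ F, ρ a (φ t) • f (p a)‖
      = ‖∑ a ∈ F, ρ a (φ t) • (f t - f (p a))‖ := by
        simp only [smul_sub, Finset.sum_sub_distrib]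
        rw [← hft]
    _ ≤ ∑ a ∈ F, ‖ρ a (φ t) • (f t - f (p a))‖ := norm_sum_le _ _
    _ ≤ ∑ a ∈ F, ψ a (φ t) / Ψ (φ t) * ε := by
        refine Finset.sum_le_sum fun a _ => ?_
        have h0 : 0 ≤ ψ a (φ t) / Ψ (φ t) := div_nonneg (hψ0 _ _) (hΨ _).le
        rw [norm_smul]
        change ‖((ψ a (φ t) / Ψ (φ t) : ℝ) : ℂ)‖ * _ ≤ _
        rw [Complex.norm_real, Real.norm_of_nonneg h0]
        -- Where the bump is nonzero, `t - p a` is an `ε`-period, since the norm on `K` controls the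
        -- variation of `f`.
        by_cases hlt : ‖φ t - φ (p a)‖ < ε
        · refine mul_le_mul_of_nonneg_left ?_ h0
          rw [← map_sub] at hlt
          exact (hclose _ (p a) t (by ring)).trans hlt.le
        · have : ψ a (φ t) = 0 := max_eq_right (by linarith)
          simp [this]
    _ = ε := by rw [← Finset.sum_mul, hsum, one_mul]

end Approximation

/-! ### Mean values and the two inclusions -/

section Mean

open MeasureTheory Filter Topology

variable {E : Type*} [NormedAddCommGroup E] {I : Set ℝ}

theorem extend_apply_of_mem (f : I → E) {s : ℝ} (hs : s ∈ I) :
    Function.extend ((↑) : I → ℝ) f 0 s = f ⟨s, hs⟩ :=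
  Subtype.val_injective.extend_apply f 0 ⟨s, hs⟩

theorem intervalIntegrable_extend (hI : I = Set.univ ∨ I = Set.Ici 0) {f : I → E}
    (hf : Continuous f) {a b : ℝ} (ha : 0 ≤ a) (hb : 0 ≤ b) :
    IntervalIntegrable (Function.extend ((↑) : I → ℝ) f 0) volume a b := by
  refine ContinuousOn.intervalIntegrable ?_
  have hsub : Set.uIcc a b ⊆ I := fun s hs => mem_of_nonneg hI ((le_min ha hb).trans hs.1)
  refine ContinuousOn.mono ?_ hsub
  rw [continuousOn_iff_continuous_domRestrict]
  convert! hf using 1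
  funext t
  exact extend_apply_of_mem f t.2

variable [NormedSpace ℂ E]

/-- The average `(1/t) ∫₀ᵗ f`. -/
noncomputable def avg (f : I → E) (t : ℝ) : E :=
  t⁻¹ • ∫ s in (0 : ℝ)..t, Function.extend ((↑) : I → ℝ) f 0 s

theorem hasBohrFourierCoeff_zero_iff (f : I → E) (a : E) :
    HasBohrFourierCoeff f 0 a ↔ Tendsto (avg f) atTop (𝓝 a) := by
  simp only [HasBohrFourierCoeff, Complex.ofReal_zero, mul_zero, zero_mul, neg_zero,
    Complex.exp_zero, one_smul]
  rfl

theorem avg_add (hI : I = Set.univ ∨ I = Set.Ici 0) {f g : I → E} (hf : Continuous f)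
    (hg : Continuous g) {t : ℝ} (ht : 0 ≤ t) : avg (f + g) t = avg f t + avg g t := by
  rw [avg, avg, avg, ← smul_add, ← intervalIntegral.integral_add
    (intervalIntegrable_extend hI hf le_rfl ht) (intervalIntegrable_extend hI hg le_rfl ht)]
  congr 1
  refine intervalIntegral.integral_congr fun s hs => ?_
  rw [Set.uIcc_of_le ht] at hs
  have hs' := mem_of_nonneg hI hs.1
  simp only [extend_apply_of_mem _ hs', Pi.add_apply]

theorem avg_smul (hI : I = Set.univ ∨ I = Set.Ici 0) (f : I → E) (a : ℂ) {t : ℝ} (ht : 0 ≤ t) :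
    avg (a • f) t = a • avg f t := by
  rw [avg, avg, smul_comm a, ← intervalIntegral.integral_smul (μ := volume) a]
  congr 1
  refine intervalIntegral.integral_congr fun s hs => ?_
  rw [Set.uIcc_of_le ht] at hs
  have hs' := mem_of_nonneg hI hs.1
  simp only [extend_apply_of_mem _ hs', Pi.smul_apply]

theorem avg_const [CompleteSpace E] (hI : I = Set.univ ∨ I = Set.Ici 0) (a : E) {t : ℝ}
    (ht : 0 < t) : avg (fun _ : I => a) t = a := by
  have h : ∫ s in (0 : ℝ)..t, Function.extend ((↑) : I → ℝ) (fun _ => a) 0 s =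
      ∫ _ in (0 : ℝ)..t, a := by
    refine intervalIntegral.integral_congr fun s hs => ?_
    rw [Set.uIcc_of_le ht.le] at hs
    exact extend_apply_of_mem _ (mem_of_nonneg hI hs.1)
  rw [avg, h, intervalIntegral.integral_const, sub_zero, smul_smul, inv_mul_cancel₀ ht.ne',
    one_smul]

theorem norm_avg_le (hI : I = Set.univ ∨ I = Set.Ici 0) {f : I → E} {ε : ℝ}
    (h : ∀ t, ‖f t‖ ≤ ε) {t : ℝ} (ht : 0 < t) : ‖avg f t‖ ≤ ε := by
  rw [avg, norm_smul, norm_inv, Real.norm_of_nonneg ht.le, inv_mul_le_iff₀ ht]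
  have := intervalIntegral.norm_integral_le_of_norm_le_const (a := 0) (b := t) (C := ε)
    (f := Function.extend ((↑) : I → ℝ) f 0) fun s hs => by
      rw [Set.uIoc_of_le ht.le] at hs
      rw [extend_apply_of_mem f (mem_of_nonneg hI hs.1.le)]
      exact h _
  rw [sub_zero, abs_of_pos ht] at this
  linarith

/-- The continuous functions with mean value zero. -/
noncomputable def zeroMean (hI : I = Set.univ ∨ I = Set.Ici 0) (E : Type*)
    [NormedAddCommGroup E] [NormedSpace ℂ E] : Submodule ℂ (I → E) where
  carrier := {f | Continuous f ∧ Tendsto (avg f) atTop (𝓝 0)}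
  zero_mem' := ⟨continuous_const, by
    refine tendsto_const_nhds.congr' ?_
    filter_upwards [eventually_ge_atTop 0] with t ht
    have := avg_smul hI (0 : I → E) 0 ht
    rw [zero_smul, zero_smul] at this
    exact this.symm⟩
  add_mem' := fun {f g} hf hg => ⟨hf.1.add hg.1, by
    have := hf.2.add hg.2
    rw [add_zero] at this
    refine this.congr' ?_
    filter_upwards [eventually_ge_atTop 0] with t ht
    exact (avg_add hI hf.1 hg.1 ht).symm⟩
  smul_mem' := fun a f hf => ⟨hf.1.const_smul a, by
    have := hf.2.const_smul a
    rw [smul_zero] at this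
    refine this.congr' ?_
    filter_upwards [eventually_ge_atTop 0] with t ht
    exact (avg_smul hI f a ht).symm⟩

theorem mem_zeroMean_of_forall (hI : I = Set.univ ∨ I = Set.Ici 0) {f : I → E}
    (hf : Continuous f) (h : ∀ ε : ℝ, 0 < ε → ∃ g ∈ zeroMean hI E, ∀ t, ‖f t - g t‖ ≤ ε) :
    f ∈ zeroMean hI E := by
  refine ⟨hf, ?_⟩
  rw [Metric.tendsto_atTop']
  intro ε hε
  obtain ⟨g, ⟨hgc, hg⟩, hfg⟩ := h (ε / 2) (half_pos hε)
  obtain ⟨N, hN⟩ := (Metric.tendsto_atTop'.1 hg) (ε / 2) (half_pos hε)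
  refine ⟨max N 0, fun t ht => ?_⟩
  rw [gt_iff_lt, max_lt_iff] at ht
  have h1 := hN t ht.1
  rw [dist_zero_right] at h1 ⊢
  have h2 := norm_avg_le hI (f := f - g) hfg ht.2
  have h3 := avg_add hI (hf.sub hgc) hgc ht.2.le
  rw [show f - g + g = f from sub_add_cancel f g] at h3
  rw [h3]
  exact (norm_add_le _ _).trans_lt (by linarith)

variable {c : ℂ} {f : I → E}

/-- The integrals over `[0, t]` and `[τ, t + τ]` differ by at most `2 * M * τ`, while the second is
`c` times the first up to `ε * t`. -/
theorem norm_sub_one_mul_norm_avg_le (hI : I = Set.univ ∨ I = Set.Ici 0) (hf : Continuous f)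
    {M : ℝ} (hM : ∀ t, ‖f t‖ ≤ M) {ε τ : ℝ} (hτ : IsApproxPeriod f c ε τ) {t : ℝ} (ht : 0 < t) :
    ‖c - 1‖ * ‖avg f t‖ ≤ ε + 2 * M * τ / t := by
  set F := Function.extend ((↑) : I → ℝ) f 0 with hF
  have hint : ∀ {a b : ℝ}, 0 ≤ a → 0 ≤ b → IntervalIntegrable F volume a b :=
    fun ha hb => intervalIntegrable_extend hI hf ha hb
  have hτ0 := hτ.1.le
  have hshift : ∫ s in (0 : ℝ)..t, F (s + τ) = ∫ s in τ..(t + τ), F s := by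
    rw [intervalIntegral.integral_comp_add_right (fun s => F s) τ, zero_add]
  have hshift_int : IntervalIntegrable (fun s => F (s + τ)) volume 0 t := by
    have := (hint hτ0 (add_nonneg ht.le hτ0)).comp_add_right τ
    simpa using this
  have hF_le : ∀ {s : ℝ}, 0 ≤ s → ‖F s‖ ≤ M := fun hs => by
    rw [hF, extend_apply_of_mem f (mem_of_nonneg hI hs)]
    exact hM _
  have h1 : ‖∫ s in (0 : ℝ)..t, (F (s + τ) - c • F s)‖ ≤ ε * t := by
    have := intervalIntegral.norm_integral_le_of_norm_le_const (a := 0) (b := t) (C := ε)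
      (f := fun s => F (s + τ) - c • F s) fun s hs => by
        rw [Set.uIoc_of_le ht.le] at hs
        rw [hF, extend_apply_of_mem f (mem_of_nonneg hI hs.1.le),
          extend_apply_of_mem f (mem_of_nonneg hI (add_nonneg hs.1.le hτ0))]
        exact hτ.2 _ _ rfl
    rwa [sub_zero, abs_of_pos ht] at this
  have h2 : ‖∫ s in t..(t + τ), F s‖ ≤ M * τ := by
    have := intervalIntegral.norm_integral_le_of_norm_le_const (a := t) (b := t + τ) (C := M)
      (f := F) fun s hs => by
        rw [Set.uIoc_of_le (by linarith)] at hs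
        exact hF_le (ht.le.trans hs.1.le)
    rwa [add_sub_cancel_left, abs_of_nonneg hτ0] at this
  have h3 : ‖∫ s in (0 : ℝ)..τ, F s‖ ≤ M * τ := by
    have := intervalIntegral.norm_integral_le_of_norm_le_const (a := 0) (b := τ) (C := M)
      (f := F) fun s hs => by
        rw [Set.uIoc_of_le hτ0] at hs
        exact hF_le hs.1.le
    rwa [sub_zero, abs_of_nonneg hτ0] at this
  have h4 : (c - 1) • ∫ s in (0 : ℝ)..t, F s =
      (∫ s in t..(t + τ), F s) - (∫ s in (0 : ℝ)..τ, F s) -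
        ∫ s in (0 : ℝ)..t, (F (s + τ) - c • F s) := by
    have hc_int : IntervalIntegrable (fun s => c • F s) volume 0 t := (hint le_rfl ht.le).smul c
    rw [intervalIntegral.integral_sub hshift_int hc_int, hshift,
      intervalIntegral.integral_smul, sub_smul, one_smul]
    have h5 := intervalIntegral.integral_add_adjacent_intervals
      (hint le_rfl hτ0) (hint hτ0 (add_nonneg ht.le hτ0))
    have h6 := intervalIntegral.integral_add_adjacent_intervals
      (hint le_rfl ht.le) (hint ht.le (add_nonneg ht.le hτ0))
    rw [← h5] at h6
    rw [← sub_eq_zero] at h6 ⊢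
    rw [← neg_eq_zero, ← h6]
    abel
  have h7 : ‖c - 1‖ * ‖∫ s in (0 : ℝ)..t, F s‖ ≤ ε * t + 2 * M * τ := by
    rw [← norm_smul, h4]
    refine (norm_sub_le _ _).trans ?_
    have := norm_sub_le (∫ s in t..(t + τ), F s) (∫ s in (0 : ℝ)..τ, F s)
    linarith
  rw [avg, norm_smul, norm_inv, Real.norm_of_nonneg ht.le]
  calc ‖c - 1‖ * (t⁻¹ * ‖∫ s in (0 : ℝ)..t, F s‖)
      = (‖c - 1‖ * ‖∫ s in (0 : ℝ)..t, F s‖) / t := by rw [div_eq_mul_inv]; ring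
    _ ≤ (ε * t + 2 * M * τ) / t := by gcongr
    _ = _ := by field_simp

theorem mem_zeroMean_of_mem_cAP (hI : I = Set.univ ∨ I = Set.Ici 0) (hc : ‖c‖ = 1) (hc1 : c ≠ 1)
    (hf : f ∈ cAP c I E) : f ∈ zeroMean hI E := by
  obtain ⟨M, hM⟩ := exists_norm_le_of_mem_cAP hI hc hf
  refine ⟨hf.1, ?_⟩
  have hc' : 0 < ‖c - 1‖ := norm_pos_iff.2 (sub_ne_zero.2 hc1)
  rw [Metric.tendsto_atTop']
  intro ε hε
  obtain ⟨l, hl, h⟩ := hf.2 (‖c - 1‖ * ε / 2) (by positivity)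
  obtain ⟨τ, hτ, -⟩ := h 0 le_rfl
  have hlim : Tendsto (fun t : ℝ => 2 * M * τ / t) atTop (𝓝 0) :=
    tendsto_const_nhds.div_atTop tendsto_id
  obtain ⟨N, hN⟩ := (Metric.tendsto_atTop'.1 hlim) (‖c - 1‖ * ε / 2) (by positivity)
  refine ⟨max N 0, fun t ht => ?_⟩
  rw [gt_iff_lt, max_lt_iff] at ht
  have h1 := hN t ht.1
  rw [dist_zero_right] at h1 ⊢
  have h2 := norm_sub_one_mul_norm_avg_le hI hf.1 hM hτ ht.2
  refine lt_of_mul_lt_mul_left ?_ hc'.le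
  linarith [Real.le_norm_self (2 * M * τ / t)]

theorem cAPSpan_le_zeroMean (hI : I = Set.univ ∨ I = Set.Ici 0) (hc : ‖c‖ = 1) (hc1 : c ≠ 1) :
    cAPSpan c I E ≤ zeroMean hI E :=
  Submodule.span_le.2 fun _ hf => mem_zeroMean_of_mem_cAP hI hc hc1 hf

theorem cAPClosure_subset_APSpec (hI : I = Set.univ ∨ I = Set.Ici 0) (hc : ‖c‖ = 1)
    (hc1 : c ≠ 1) : cAPClosure c I E ⊆ APSpec {0}ᶜ I E := by
  rintro f ⟨hf, h⟩
  refine ⟨hf, ?_⟩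
  rintro r hr rfl
  refine hr ((hasBohrFourierCoeff_zero_iff f 0).2 (mem_zeroMean_of_forall hI hf.1 ?_).2)
  intro ε hε
  obtain ⟨g, hg, hfg⟩ := h ε hε
  exact ⟨g, cAPSpan_le_zeroMean hI hc hc1 hg, hfg⟩

theorem expFun_mem_cAP (hc : ‖c‖ = 1) {r : ℝ} (hr : r ≠ 0) (a : E) : expFun I r a ∈ cAP c I E := by
  refine ⟨by unfold expFun; fun_prop, fun ε hε => ?_⟩
  have hp : 0 < 2 * Real.pi / |r| := by positivity
  refine ⟨2 * Real.pi / |r|, hp, fun b hb => ?_⟩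
  -- The solutions of `e^{irτ} = c` have spacing `2π / |r|`; the window open on the left makes `τ`
  -- strictly positive even for `b = 0`.
  obtain ⟨k, hk, -⟩ := existsUnique_add_zsmul_mem_Ioc hp (c.arg / r) b
  refine ⟨_, ⟨hb.trans_lt hk.1, fun t s hs => ?_⟩, Set.Ioc_subset_Icc_self hk⟩
  have hexp : Complex.exp (Complex.I * r * (s : ℝ)) =
      c * Complex.exp (Complex.I * r * (t : ℝ)) := by
    have hcexp : c = Complex.exp (c.arg * Complex.I) := by
      have := Complex.norm_mul_exp_arg_mul_I c
      rw [hc, Complex.ofReal_one, one_mul] at this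
      exact this.symm
    obtain ⟨m, hm⟩ : ∃ m : ℤ, r * (k • (2 * Real.pi / |r|)) = m * (2 * Real.pi) := by
      rcases abs_choice r with h | h
      · refine ⟨k, ?_⟩
        rw [h, zsmul_eq_mul]
        field_simp
      · refine ⟨-k, ?_⟩
        rw [h, zsmul_eq_mul]
        push_cast
        field_simp
    have hrs : r * s = r * t + c.arg + m * (2 * Real.pi) := by
      rw [hs, mul_add, mul_add, hm, mul_div_cancel₀ _ hr]
      ring
    have hrsC : (r : ℂ) * (s : ℝ) = r * (t : ℝ) + c.arg + m * (2 * Real.pi) := by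
      exact_mod_cast hrs
    rw [mul_assoc, hrsC]
    conv_rhs => enter [1]; rw [hcexp]
    rw [← Complex.exp_add, Complex.exp_eq_exp_iff_exists_int]
    exact ⟨m, by ring⟩
  simp only [expFun]
  rw [hexp, mul_smul, sub_self, norm_zero]
  exact hε.le

theorem trigSpan_le_cAPSpan (hc : ‖c‖ = 1) : trigSpan {0}ᶜ I E ≤ cAPSpan c I E := by
  refine Submodule.span_le.2 ?_
  rintro _ ⟨r, hr, a, rfl⟩
  exact Submodule.subset_span (expFun_mem_cAP hc hr a)

theorem exists_const_add_of_mem_trigSpan {p : I → E} (hp : p ∈ trigSpan Set.univ I E) :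
    ∃ a : E, ∃ q ∈ trigSpan {0}ᶜ I E, p = (fun _ => a) + q := by
  refine Submodule.span_induction
    (p := fun p _ => ∃ a : E, ∃ q ∈ trigSpan {0}ᶜ I E, p = (fun _ => a) + q)
    ?_ ?_ ?_ ?_ hp
  · rintro _ ⟨r, -, a, rfl⟩
    by_cases hr : r = 0
    · refine ⟨a, 0, Submodule.zero_mem _, ?_⟩
      funext t
      simp [expFun, hr]
    · exact ⟨0, _, Submodule.subset_span ⟨r, hr, a, rfl⟩, by funext t; simp⟩
  · exact ⟨0, 0, Submodule.zero_mem _, by funext t; simp⟩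
  · rintro _ _ - - ⟨a, p, hp, rfl⟩ ⟨b, q, hq, rfl⟩
    refine ⟨a + b, p + q, Submodule.add_mem _ hp hq, ?_⟩
    funext t
    simp only [Pi.add_apply]
    abel
  · rintro b _ - ⟨a, p, hp, rfl⟩
    refine ⟨b • a, b • p, Submodule.smul_mem _ _ hp, ?_⟩
    funext t
    simp

theorem APSpec_subset_cAPClosure [CompleteSpace E] (hI : I = Set.univ ∨ I = Set.Ici 0)
    (hc : ‖c‖ = 1) : APSpec {0}ᶜ I E ⊆ cAPClosure c I E := by
  rintro f ⟨hf, hspec⟩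
  refine ⟨hf, fun ε hε => ?_⟩
  have hmean : Tendsto (avg f) atTop (𝓝 0) := by
    rw [← hasBohrFourierCoeff_zero_iff]
    by_contra h
    exact hspec h rfl
  have hf' := (mem_AP_iff f).1 hf
  obtain ⟨p, hp, hfp⟩ := hf'.mem_uniformClosure_trigSpan hI (ε / 2) (half_pos hε)
  obtain ⟨a, q, hq, rfl⟩ := exists_const_add_of_mem_trigSpan hp
  have hqm : q ∈ zeroMean hI E :=
    -- Nonzero frequencies have mean zero whatever `c` is; `-1` serves as an auxiliary value
    -- different from `1`.
    cAPSpan_le_zeroMean (c := -1) hI (by simp) (by norm_num) (trigSpan_le_cAPSpan (by simp) hq)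
  have hfq : f - q ∈ zeroMean hI E := Submodule.sub_mem _ ⟨hf'.1, hmean⟩ hqm
  have ha : ‖a‖ ≤ ε / 2 := by
    -- The constant term is the limit of the averages of `p - f`, a function bounded by `ε / 2`,
    -- where `p` is the approximating polynomial.
    have hlim : Tendsto (fun t => ‖a + avg (-(f - q)) t‖) atTop (𝓝 ‖a + 0‖) :=
      (((zeroMean hI E).neg_mem hfq).2.const_add a).norm
    rw [add_zero] at hlim
    refine le_of_tendsto hlim ?_
    filter_upwards [eventually_gt_atTop 0] with t ht
    have h1 := avg_add hI (continuous_const (y := a)) ((zeroMean hI E).neg_mem hfq).1 ht.le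
    rw [avg_const hI a ht] at h1
    rw [← h1]
    refine norm_avg_le hI (fun s => ?_) ht
    have := hfp s
    rw [norm_sub_rev] at this
    convert! this using 2
    simp only [Pi.add_apply, Pi.neg_apply, Pi.sub_apply]
    abel
  refine ⟨q, trigSpan_le_cAPSpan hc hq, fun t => ?_⟩
  calc ‖f t - q t‖ = ‖(f t - ((fun _ : I => a) + q) t) + a‖ := by
        simp only [Pi.add_apply]; congr 1; abel
    _ ≤ _ := norm_add_le _ _
    _ ≤ ε := by linarith [hfp t]

end Mean

end CAlmostPeriodic

theorem theorem2p13 {E : Type*} [NormedAddCommGroup E] [NormedSpace ℂ E] [CompleteSpace E]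
    (I : Set ℝ) (hI : I = Set.univ ∨ I = Set.Ici 0) (c : ℂ) (hc : ‖c‖ = 1) :
    (CAlmostPeriodic.cAPSpan c I E : Set (I → E)) ⊆ CAlmostPeriodic.AP I E ∧
    (c ≠ 1 → (∃ q : ℚ, Complex.arg c = Real.pi * q) →
      CAlmostPeriodic.cAPClosure c I E = CAlmostPeriodic.APSpec {0}ᶜ I E) ∧
    ((¬ ∃ q : ℚ, Complex.arg c = Real.pi * q) →
      CAlmostPeriodic.APSpec {0}ᶜ I E ⊆ CAlmostPeriodic.cAPClosure c I E) :=
  ⟨CAlmostPeriodic.cAPSpan_subset_AP hI hc,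
    fun hc1 _ => (CAlmostPeriodic.cAPClosure_subset_APSpec hI hc hc1).antisymm
      (CAlmostPeriodic.APSpec_subset_cAPClosure hI hc),
    fun _ => CAlmostPeriodic.APSpec_subset_cAPClosure hI hc⟩
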